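/- Let $k$ be a non-Archimedean local field of characteristic $0$, let $k=K_1\subset K_2\subset\cdots$ be an increasing sequence of finite extensions of $k$, and let $K=\bigcup_n K_n$. Let $m_n=[K_n:k]$, let $q_n$ be the cardinality of the residue field of $K_n$, $e_n$ the ramification index of $K_n/k$ and $d_n$ the exponent of the different of $K_n/k$. Let $|\cdot|_1$ be the normalized absolute value of $k$, $|x|_n=|N_{K_n/k}(x)|_1$ the normalized absolute value of $K_n$, and let $\|\cdot\|$ be the absolute value on $K$ that extends $|\cdot|_1$, so that $\|x\|=|x|_n^{1/m_n}$ for $x\in K_n$. Let $T_n:K\to K_n$ be given by $T_n(x)=\frac{m_n}{m_\nu}\mathrm{Tr}_{K_\nu/K_n}(x)$ for $x\in K_\nu$, $\nu\ge n$, and put $T=T_1$. Let $\overline K=\{(x_n)\in\prod_n K_n:\ x_n=T_n(x_\nu)\text{ for all }\nu\ge n\}$, with the topology given by the seminorms $x\mapsto\|x_n\|$, its Borel $\sigma$-algebra, and the maps $T_n(x)=x_n$ on $\overline K$; for $a\in K_n$ and $x\in\overline K$ let $\langle a,x\rangle=T(ax_n)$. Let $\chi$ be a continuous additive character of $k$ with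 values in the unit circle and of rank zero (trivial on the ring of integers of $k$, but on no larger ball around $0$), and let $\Omega$ be the indicator function of $\{a\in K:\|a\|\le 1\}$. Finally, let $\mathcal D(\overline K)$ be the set of functions $x\mapsto\varphi(T_n(x))$ with $n\ge 1$ and $\varphi:K_n\to\mathbb C$ locally constant with compact support, and let $$S=\{x\in\overline K:\ \|T_n(x)\|\le q_n^{d_n/m_n}\|m_n\|\ \text{ for all } n\ge 1\}.$$ Theorem 1. There is exactly one Radon probability measure $\mu$ on $\overline K$ with $\int_{\overline K}\chi(\langle a,x\rangle)\,d\mu(x)=\Omega(a)$ for all $a\in K$. It has the following properties. (a) $\mu$ is concentrated on $S$, that is, $\mu(\overline K\setminus S)=0$. (b) $\mu$ is invariant under additive shifts by elements of $S$. (c) The shift of $\mu$ by any element of $\overline K\setminus S$ is orthogonal to $\mu$ (mutually singular with $\mu$). (d) If $0\ne a\in K_n$ and $|a|_n=q_n^N$ with $N\in\mathbb Z$, then the essential supremum over $x\in\overline K$, with respect to $\mu$, of $|\langle a,x\rangle|_1$ equals $q_1^{-[-N/e_n]}$, where $[\cdot]$ is the integer part (floor). (e) For every $s\in[1,\infty)$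 the set $\mathcal D(\overline K)$ is contained and dense in the complex space $L_s(\overline K)=L_s(\overline K,\mu)$. -/

import Mathlib

open MeasureTheory
open scoped NormedField ENNReal

noncomputable section

namespace LocalFieldTower

/-! ### Local fields and their finite extensions

A non-Archimedean local field `k` of characteristic zero, with its absolute value as norm, is a
`NontriviallyNormedField` with `IsUltrametricDist k`, `ProperSpace k` (closed balls are compact) and
`CharZero k`. `Valued.integer L`, `Valued.maximalIdeal L` and `Valued.ResidueField L` are
`{x | ‖x‖ ≤ 1}`, its maximal ideal and the residue field. -/

/-- The cardinality `q` of the residue field. -/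
def residueCard (L : Type*) [NormedField L] [IsUltrametricDist L] : ℕ :=
  Nat.card (Valued.ResidueField L)

/-- The norm of `k` is the normalized absolute value: a uniformizer has norm `q⁻¹`. -/
def IsNormalized (k : Type*) [NormedField k] [IsUltrametricDist k] : Prop :=
  ∃ ϖ : Valued.integer k, Irreducible ϖ ∧ ‖(ϖ : k)‖ = (residueCard k : ℝ)⁻¹

/-- `χ` is a (continuous, unitary) additive character of rank zero: the balls around `0` on which
it is trivial are exactly those contained in the ring of integers. -/
def IsRankZero {k : Type*} [NormedField k] (χ : AddChar k Circle) : Prop :=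
  Continuous χ ∧ ∀ c : k, (∀ x : k, ‖x‖ ≤ ‖c‖ → χ x = 1) ↔ ‖c‖ ≤ 1

section Extension

variable {k K : Type*} [NontriviallyNormedField k] [IsUltrametricDist k]
  [NormedField K] [NormedAlgebra k K] [IsUltrametricDist K]

instance hasExtension (E : IntermediateField k K) :
    (Valued.v (R := k)).HasExtension (Valued.v (R := E)) := by
  refine ⟨?_⟩
  rw [Valuation.isEquiv_iff_val_le_one]
  intro x
  simp [NormedField.v_eq_valuation]

instance isDiscreteValuationRing [ProperSpace k] (E : IntermediateField k K)
    [FiniteDimensional k E] : IsDiscreteValuationRing (Valued.integer E) := by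
  have hp : ProperSpace E := FiniteDimensional.proper k E
  have hset : ((Valued.integer E : Subring E) : Set E) = Metric.closedBall 0 1 := by
    ext x
    simp [Valuation.mem_integer_iff, ← NNReal.coe_le_coe]
  have hc : CompactSpace (Valued.integer E) :=
    isCompact_iff_compactSpace.mp (hset ▸ isCompact_closedBall (0 : E) 1)
  have hn : (Valued.v (R := E)).IsNontrivial := by
    obtain ⟨x, hx0, hx1⟩ := NormedField.exists_norm_lt_one k
    refine ⟨algebraMap k E x, ?_, ?_⟩
    · have : x ≠ 0 := norm_pos_iff.mp hx0
      simpa using this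
    · intro h
      have h2 : ‖algebraMap k E x‖₊ = 1 := h
      rw [nnnorm_algebraMap'] at h2
      have h3 : ‖x‖ = 1 := congrArg NNReal.toReal h2
      linarith
  exact Valued.integer.isDiscreteValuationRing_of_compactSpace

/-- The degree `m` of a finite extension `E / k`. -/
def degree (E : IntermediateField k K) : ℕ := Module.finrank k E

/-- The exponent `d` of the different of a finite extension `E / k`. -/
def differentExponent [ProperSpace k] (E : IntermediateField k K) [FiniteDimensional k E] : ℕ :=
  multiplicity (Valued.maximalIdeal E) (differentIdeal (Valued.integer k) (Valued.integer E))

/-- The ramification index `e` of `E / k`. -/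
def ramificationIndex (E : IntermediateField k K) : ℕ :=
  (Valued.maximalIdeal E).ramificationIdx (Valued.integer k)

/-- The normalized absolute value `|x| = |N_{E/k}(x)|_k` of a finite extension `E / k`
(when the norm of `k` is normalized). -/
def normalizedAbs (E : IntermediateField k K) (x : E) : ℝ := ‖Algebra.norm k x‖

end Extension

/-! ### The projective limit -/

section Limit

variable {k K : Type*} [NontriviallyNormedField k] [CharZero k]
  [NormedField K] [NormedAlgebra k K] [Algebra.IsAlgebraic k K]

instance charZero (E : IntermediateField k K) : CharZero E :=
  charZero_of_injective_algebraMap (algebraMap k E).injective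

instance isIntegral (E : IntermediateField k K) : Algebra.IsIntegral E K :=
  Algebra.IsIntegral.tower_top k

/-- The map `T_E : K → E`, equal to `[K' : E]⁻¹ Tr_{K'/E}(x)` if `x` lies in the finite extension
`K'` of `E`. -/
def T (E : IntermediateField k K) : K →ₗ[E] E := Algebra.normalizedTrace E K

/-- The projective limit `K̄` of the fields `F n` with respect to the maps `T (F n)`. As a subspace
of the product of the normed fields `F n`, it has the topology given by the seminorms
`x ↦ ‖x n‖`. -/
def KBar (F : ℕ → IntermediateField k K) : AddSubgroup (∀ n, F n) where
  carrier := {x | ∀ n ν, n ≤ ν → x n = T (F n) (x ν : K)}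
  zero_mem' := by intro n ν _; simp
  add_mem' := by
    intro x y hx hy n ν h
    simp [hx n ν h, hy n ν h]
  neg_mem' := by
    intro x hx n ν h
    simp [hx n ν h]

/-- `K̄` carries its Borel σ-algebra. -/
instance (F : ℕ → IntermediateField k K) : MeasurableSpace (KBar F) := borel _

instance (F : ℕ → IntermediateField k K) : BorelSpace (KBar F) := ⟨rfl⟩

/-- The pairing `⟨a, x⟩ = T(a xₙ)` of `a ∈ F n ⊆ K` and `x ∈ K̄`, where `T : K → k` is the
normalized trace. -/
def pairing (F : ℕ → IntermediateField k K) (n : ℕ) (a : F n) (x : KBar F) : k :=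
  Algebra.normalizedTrace k K ((a : K) * (x.1 n : K))

/-- The indicator `Ω` of the unit ball of `K`. -/
def Omega (a : K) : ℂ := Set.indicator {a : K | ‖a‖ ≤ 1} 1 a

/-- `μ` is a Radon probability measure on `K̄` with Fourier transform `Ω`. -/
structure IsGaussian (F : ℕ → IntermediateField k K) (χ : AddChar k Circle)
    (μ : Measure (KBar F)) : Prop where
  prob : IsProbabilityMeasure μ
  radon : μ.InnerRegular
  fourier : ∀ (n : ℕ) (a : F n), ∫ x, (χ (pairing F n a x) : ℂ) ∂μ = Omega (a : K)

/-- The set `S` of all `x ∈ K̄` with `‖Tₙ(x)‖ ≤ qₙ^{dₙ/mₙ} ‖mₙ‖` for all `n`. -/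
def S [IsUltrametricDist k] [ProperSpace k] [IsUltrametricDist K]
    (F : ℕ → IntermediateField k K) [∀ n, FiniteDimensional k (F n)] : Set (KBar F) :=
  {x | ∀ n, ‖(x.1 n : K)‖ ≤
    (residueCard (F n) : ℝ) ^ ((differentExponent (F n) : ℝ) / (degree (F n) : ℝ)) *
      ‖(degree (F n) : K)‖}

/-- The cylindrical test functions `x ↦ φ(Tₙ(x))`, with `φ` locally constant and compactly
supported on `F n`. -/
def testFunctions (F : ℕ → IntermediateField k K) : Set (KBar F → ℂ) :=
  {f | ∃ (n : ℕ) (φ : F n → ℂ), IsLocallyConstant φ ∧ HasCompactSupport φ ∧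
    f = fun x => φ (x.1 n)}

end Limit

end LocalFieldTower

end

open LocalFieldTower

set_option linter.unusedSectionVars false

/-! The measure is the Haar probability measure of the compact group `S`, pushed forward to `KBar
F`. The radius in the definition of `S` is the one for which the ball in `F n` is the dual of the
integers under `(b, x) ↦ T(b x)`: this is the inverse different, scaled by the degree
(`mem_dualBall_iff`). Hence `S` is a group, and it is compact as a closed subset of a product of
balls. Invariance is immediate, and a shift by `y ∉ S` lives on a coset disjoint from `S`.

For `‖a‖ ≤ 1` the character `χ ⟨a, ·⟩` is trivial on `S`. For `‖a‖ > 1` it is nontrivial, so its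
integral vanishes. Nontriviality needs two facts: the dual ball determines the unit ball
(`norm_le_one_of_mul_mem_dualBall`), and `S` projects onto every dual ball
(`exists_mem_subgroupS_coord_eq`), because normalized traces are surjective between dual balls
(`exists_T_eq`). The same facts give the essential supremum, since Haar measure charges open sets
meeting `S`.

Uniqueness holds because the characters span a point-separating star algebra on a Polish space.
Density of test functions is Stone–Weierstrass on `S`. -/

namespace LocalFieldTower

/-! ### Norms and units in the ring of integers -/

section NormedField

variable {L : Type*} [NormedField L] [IsUltrametricDist L]

theorem mem_integer_iff_norm_le_one {x : L} : x ∈ Valued.integer L ↔ ‖x‖ ≤ 1 :=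
  Iff.rfl

theorem norm_le_one_of_integer (x : Valued.integer L) : ‖(x : L)‖ ≤ 1 :=
  mem_integer_iff_norm_le_one.mp x.2

theorem integer_isUnit_iff {x : Valued.integer L} : IsUnit x ↔ ‖(x : L)‖ = 1 := by
  rw [(Valuation.integer.integers (Valued.v (R := L))).isUnit_iff_valuation_eq_one]
  exact NNReal.coe_inj.symm

/-- The norm of a nonzero element is an integral power of the norm of a uniformizer. -/
theorem exists_norm_eq_zpow [IsDiscreteValuationRing (Valued.integer L)]
    {ϖ : Valued.integer L} (hϖ : Irreducible ϖ) {x : L} (hx : x ≠ 0) :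
    ∃ n : ℤ, ‖x‖ = ‖(ϖ : L)‖ ^ n := by
  have key : ∀ y : L, y ≠ 0 → ‖y‖ ≤ 1 → ∃ n : ℤ, ‖y‖ = ‖(ϖ : L)‖ ^ n := by
    intro y hy hy1
    have h0 : (⟨y, mem_integer_iff_norm_le_one.mpr hy1⟩ : Valued.integer L) ≠ 0 :=
      fun h => hy (congrArg Subtype.val h)
    obtain ⟨n, u, hu⟩ := IsDiscreteValuationRing.eq_unit_mul_pow_irreducible h0 hϖ
    refine ⟨n, ?_⟩
    have h1 : y = (u : Valued.integer L) * (ϖ : L) ^ n := by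
      simpa using congrArg (Subtype.val) hu
    have h2 : ‖((u : Valued.integer L) : L)‖ = 1 := integer_isUnit_iff.mp u.isUnit
    rw [h1, norm_mul, h2, one_mul, norm_pow, zpow_natCast]
  rcases le_total ‖x‖ 1 with h | h
  · exact key x hx h
  · obtain ⟨n, hn⟩ := key x⁻¹ (inv_ne_zero hx) (by rw [norm_inv]; exact inv_le_one_of_one_le₀ h)
    refine ⟨-n, ?_⟩
    rw [zpow_neg, ← hn, norm_inv, inv_inv]

theorem norm_irreducible_pos {ϖ : Valued.integer L} (hϖ : Irreducible ϖ) : 0 < ‖(ϖ : L)‖ :=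
  norm_pos_iff.mpr fun h => hϖ.ne_zero (Subtype.ext h)

theorem norm_irreducible_lt_one {ϖ : Valued.integer L} (hϖ : Irreducible ϖ) : ‖(ϖ : L)‖ < 1 :=
  lt_of_le_of_ne (norm_le_one_of_integer ϖ) fun h => hϖ.not_isUnit (integer_isUnit_iff.mpr h)

end NormedField

theorem norm_eq_of_associated {L : Type*} [NormedField L] [IsUltrametricDist L]
    {x y : Valued.integer L} (h : Associated x y) : ‖(x : L)‖ = ‖(y : L)‖ := by
  obtain ⟨u, rfl⟩ := h
  have h2 : ‖((u : Valued.integer L) : L)‖ = 1 := integer_isUnit_iff.mp u.isUnit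
  rw [MulMemClass.coe_mul, norm_mul, h2, mul_one]

/-- The norm factors through `F(x)`, where it is the signed constant coefficient; the exponent is `r
= [L : F(x)]`. -/
theorem _root_.Algebra.exists_norm_eq_minpoly_coeff_zero_pow (F : Type*) {L : Type*} [Field F]
    [Field L] [Algebra F L] [FiniteDimensional F L] (x : L) :
    ∃ r : ℕ, (minpoly F x).natDegree * r = Module.finrank F L ∧ Algebra.norm F x =
      ((-1) ^ (minpoly F x).natDegree * (minpoly F x).coeff 0) ^ r := by
  have hx : IsIntegral F x := IsIntegral.of_finite F x
  refine ⟨Module.finrank (IntermediateField.adjoin F {x}) L, ?_, ?_⟩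
  · rw [← IntermediateField.adjoin.finrank hx, Module.finrank_mul_finrank]
  · have h := Algebra.PowerBasis.norm_gen_eq_coeff_zero_minpoly
      (IntermediateField.adjoin.powerBasis hx)
    rw [IntermediateField.adjoin.powerBasis_gen, IntermediateField.minpoly_gen,
      IntermediateField.adjoin.powerBasis_dim] at h
    rw [Algebra.norm_eq_norm_adjoin, h]

theorem _root_.IsDiscreteValuationRing.eq_maximalIdeal_pow_multiplicity {R : Type*} [CommRing R]
    [IsDomain R] [IsDiscreteValuationRing R] {I : Ideal R} (hI : I ≠ ⊥) :
    I = IsLocalRing.maximalIdeal R ^ multiplicity (IsLocalRing.maximalIdeal R) I := by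
  obtain ⟨ϖ, hϖ⟩ := IsDiscreteValuationRing.exists_irreducible R
  obtain ⟨n, hn⟩ := IsDiscreteValuationRing.ideal_eq_span_pow_irreducible hI hϖ
  rw [← Ideal.span_singleton_pow, ← hϖ.maximalIdeal_eq] at hn
  have hm : IsLocalRing.maximalIdeal R ≠ 0 := IsDiscreteValuationRing.not_a_field R
  rw [hn, multiplicity_pow_self hm]
  rw [Ideal.isUnit_iff]
  exact Ideal.IsPrime.ne_top inferInstance

/-! ### Ramification, the different and the dual ball of a finite extension -/

section Extension

variable {k K : Type*} [NontriviallyNormedField k] [IsUltrametricDist k] [ProperSpace k]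
  [NormedField K] [NormedAlgebra k K] [IsUltrametricDist K]
  (E : IntermediateField k K) [FiniteDimensional k E]

instance isDiscreteValuationRing_base : IsDiscreteValuationRing (Valued.integer k) := by
  have hset : ((Valued.integer k : Subring k) : Set k) = Metric.closedBall 0 1 := by
    ext x
    simp [Valuation.mem_integer_iff, ← NNReal.coe_le_coe]
  have hc : CompactSpace (Valued.integer k) :=
    isCompact_iff_compactSpace.mp (hset ▸ isCompact_closedBall (0 : k) 1)
  have hn : (Valued.v (R := k)).IsNontrivial := by
    obtain ⟨x, hx0, hx1⟩ := NormedField.exists_norm_lt_one k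
    refine ⟨x, ?_, ?_⟩
    · have : x ≠ 0 := norm_pos_iff.mp hx0
      simpa using this
    · intro h
      have h3 : ‖x‖ = 1 := congrArg NNReal.toReal h
      linarith
  exact Valued.integer.isDiscreteValuationRing_of_compactSpace

/-- A valuation ring is integrally closed, which gives one direction. Conversely, the norm is the
spectral norm because `k` is complete, so `‖x‖ ≤ 1` forces the minimal polynomial to have integral
coefficients. -/
theorem isIntegral_integer_iff (x : E) : IsIntegral (Valued.integer k) x ↔ ‖x‖ ≤ 1 := by
  constructor
  · rintro h
    have h2 : IsIntegral (Valued.integer E) x := h.tower_top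
    obtain ⟨y, rfl⟩ := IsIntegrallyClosed.isIntegral_iff.mp h2
    exact norm_le_one_of_integer y
  · intro h
    rw [NormedAlgebra.norm_eq_spectralNorm k x, spectralNorm,
      spectralValue_le_one_iff (minpoly.monic (IsIntegral.of_finite k x))] at h
    have hl : minpoly k x ∈ Polynomial.lifts (algebraMap (Valued.integer k) k) := by
      rw [Polynomial.lifts_iff_coeff_lifts]
      intro n
      exact ⟨⟨_, mem_integer_iff_norm_le_one.mpr (h n)⟩, rfl⟩
    obtain ⟨p, hp, -, hpm⟩ := Polynomial.lifts_and_natDegree_eq_and_monic hl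
      (minpoly.monic (IsIntegral.of_finite k x))
    refine ⟨p, hpm, ?_⟩
    rw [IsScalarTower.algebraMap_eq (Valued.integer k) k E, ← Polynomial.eval₂_map, hp]
    exact minpoly.aeval k x

instance isIntegralClosure_integer :
    IsIntegralClosure (Valued.integer E) (Valued.integer k) E where
  algebraMap_injective := Subtype.val_injective
  isIntegral_iff {x} := by
    rw [isIntegral_integer_iff, ← mem_integer_iff_norm_le_one]
    exact ⟨fun h => ⟨⟨x, h⟩, rfl⟩, by rintro ⟨y, rfl⟩; exact y.2⟩

theorem norm_algebraNorm (x : E) : ‖Algebra.norm k x‖ = ‖x‖ ^ Module.finrank k E := by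
  have hx : IsIntegral k x := IsIntegral.of_finite k x
  have h1 : ‖x‖ ^ (minpoly k x).natDegree = ‖(minpoly k x).coeff 0‖ := by
    have h0 : ((minpoly k x).natDegree : ℝ) ≠ 0 := by
      exact_mod_cast (minpoly.natDegree_pos hx).ne'
    rw [NormedAlgebra.norm_eq_spectralNorm k x, spectralNorm.spectralNorm_eq_norm_coeff_zero_rpow,
      ← Real.rpow_natCast, ← Real.rpow_mul (norm_nonneg _), one_div, inv_mul_cancel₀ h0,
      Real.rpow_one]
  obtain ⟨r, hr, hn⟩ := Algebra.exists_norm_eq_minpoly_coeff_zero_pow k x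
  rw [hn, norm_pow, norm_mul, norm_pow, norm_neg, norm_one, one_pow, one_mul, ← h1, ← pow_mul, hr]

variable [CharZero k]

instance finite_integer : Module.Finite (Valued.integer k) (Valued.integer E) :=
  IsIntegralClosure.finite (Valued.integer k) k E (Valued.integer E)

theorem finrank_integer :
    Module.finrank (Valued.integer k) (Valued.integer E) = Module.finrank k E :=
  (IsFractionRing.finrank_eq (Valued.integer k) k (Valued.integer E) E).symm

instance liesOver_integer :
    (Valued.maximalIdeal E).LiesOver (Valued.maximalIdeal k) := by
  constructor
  ext x
  simp [Valued.maximalIdeal, Ideal.under]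

instance maximalIdeal_isMaximal : (Valued.maximalIdeal E).IsMaximal :=
  IsLocalRing.maximalIdeal.isMaximal _

instance maximalIdeal_base_isMaximal : (Valued.maximalIdeal k).IsMaximal :=
  IsLocalRing.maximalIdeal.isMaximal _

theorem residueCard_pow_inertiaDeg :
    residueCard E = residueCard k ^ (Valued.maximalIdeal E).inertiaDeg (Valued.integer k) := 
  (Ideal.cardQuot_pow_inertiaDeg (Valued.maximalIdeal k) (Valued.maximalIdeal E)).symm

theorem ramificationIndex_mul_inertiaDeg :
    ramificationIndex E * (Valued.maximalIdeal E).inertiaDeg (Valued.integer k) = degree E := by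
  have hp : Valued.maximalIdeal k ≠ ⊥ := IsDiscreteValuationRing.not_a_field _
  have h := IsLocalRing.primesOver_eq (Valued.integer E) hp
  -- Only one prime lies over the maximal ideal, so the sum `∑ e f = m` has a single term.
  let _ : Unique ((Valued.maximalIdeal k).primesOver (Valued.integer E)) :=
    ⟨⟨⟨Valued.maximalIdeal E, h ▸ rfl⟩⟩, fun a => Subtype.ext (by
      exact (Set.ext_iff.mp h a.1).mp a.2)⟩
  have h2 := Ideal.sum_ramification_inertia_eq_finrank (Valued.maximalIdeal k) (Valued.integer E)
  rw [Fintype.sum_unique, finrank_integer] at h2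
  exact h2

theorem norm_irreducible_pow_ramificationIndex {ϖ : Valued.integer k} (hϖ : Irreducible ϖ)
    {ϖE : Valued.integer E} (hϖE : Irreducible ϖE) :
    ‖(ϖE : E)‖ ^ ramificationIndex E = ‖(ϖ : k)‖ := by
  have hmap : (Valued.maximalIdeal k).map (algebraMap (Valued.integer k) (Valued.integer E)) =
      Ideal.span {algebraMap (Valued.integer k) (Valued.integer E) ϖ} := by
    rw [Valued.maximalIdeal, hϖ.maximalIdeal_eq, Ideal.map_span, Set.image_singleton]
  have h0 : algebraMap (Valued.integer k) (Valued.integer E) ϖ ≠ 0 := by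
    rw [Ne, FaithfulSMul.algebraMap_eq_zero_iff]
    exact hϖ.ne_zero
  have hne : (Valued.maximalIdeal k).map
      (algebraMap (Valued.integer k) (Valued.integer E)) ≠ ⊥ := by
    rw [hmap, Ne, Ideal.span_singleton_eq_bot]
    exact h0
  have h := IsDiscreteValuationRing.eq_maximalIdeal_pow_multiplicity hne
  have he : ramificationIndex E = multiplicity (IsLocalRing.maximalIdeal (Valued.integer E))
      ((Valued.maximalIdeal k).map (algebraMap (Valued.integer k) (Valued.integer E))) :=
    Ideal.IsDedekindDomain.ramificationIdx_eq_multiplicity (Valued.maximalIdeal k)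
      (Valued.maximalIdeal E) hne
  rw [← he, hmap, hϖE.maximalIdeal_eq, Ideal.span_singleton_pow,
    Ideal.span_singleton_eq_span_singleton] at h
  have h2 := norm_eq_of_associated h
  rw [SubmonoidClass.coe_pow, norm_pow] at h2
  rw [← h2]
  exact norm_algebraMap' E (ϖ : k)

/-- In terms of the normalized absolute value, a uniformizer has absolute value `q⁻¹`. -/
theorem norm_irreducible_pow_degree (hk : IsNormalized k) {ϖE : Valued.integer E}
    (hϖE : Irreducible ϖE) : ‖(ϖE : E)‖ ^ degree E = (residueCard E : ℝ)⁻¹ := by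
  obtain ⟨ϖ, hϖ, hϖn⟩ := hk
  rw [← ramificationIndex_mul_inertiaDeg, pow_mul, norm_irreducible_pow_ramificationIndex E hϖ hϖE,
    hϖn, residueCard_pow_inertiaDeg, inv_pow, Nat.cast_pow]

theorem degree_pos : 0 < degree E := Module.finrank_pos

theorem one_lt_residueCard (hk : IsNormalized k) : 1 < residueCard E := by
  obtain ⟨ϖ, hϖ⟩ := IsDiscreteValuationRing.exists_irreducible (Valued.integer E)
  have h := norm_irreducible_pow_degree E hk hϖ
  have h1 : ‖(ϖ : E)‖ ^ degree E < 1 :=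
    pow_lt_one₀ (norm_nonneg _) (norm_irreducible_lt_one hϖ) (degree_pos E).ne'
  have h0 : 0 < ‖(ϖ : E)‖ ^ degree E := pow_pos (norm_irreducible_pos hϖ) _
  rw [h] at h0 h1
  have h2 : (1 : ℝ) < residueCard E := (inv_lt_one₀ (inv_pos.mp h0)).mp h1
  exact_mod_cast h2

theorem one_lt_residueCard_base (hk : IsNormalized k) : 1 < residueCard k := by
  obtain ⟨ϖ, hϖ, hϖn⟩ := hk
  have h1 := norm_irreducible_lt_one hϖ
  have h0 := norm_irreducible_pos hϖ
  rw [hϖn] at h0 h1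
  have h2 : (1 : ℝ) < residueCard k := (inv_lt_one₀ (inv_pos.mp h0)).mp h1
  exact_mod_cast h2

/-- The inverse different, as a ball. -/
theorem forall_norm_trace_le_one_iff {ϖ : Valued.integer E} (hϖ : Irreducible ϖ) (x : E) :
    (∀ b : E, ‖b‖ ≤ 1 → ‖Algebra.trace k E (x * b)‖ ≤ 1) ↔
      ‖x‖ ≤ (‖(ϖ : E)‖ ^ differentExponent E)⁻¹ := by
  set D := FractionalIdeal.dual (Valued.integer k) k
    (1 : FractionalIdeal (nonZeroDivisors (Valued.integer E)) E) with hD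
  have hD0 : D ≠ 0 := FractionalIdeal.dual_ne_zero (Valued.integer k) k one_ne_zero
  have hdiff : (differentIdeal (Valued.integer k) (Valued.integer E) :
      FractionalIdeal (nonZeroDivisors (Valued.integer E)) E) = D⁻¹ :=
    coeIdeal_differentIdeal (Valued.integer k) k E (Valued.integer E)
  have hne : differentIdeal (Valued.integer k) (Valued.integer E) ≠ ⊥ := by
    intro h
    rw [h, FractionalIdeal.coeIdeal_bot, eq_comm, inv_eq_zero] at hdiff
    exact hD0 hdiff
  have hpow : differentIdeal (Valued.integer k) (Valued.integer E) =
      Ideal.span {ϖ ^ differentExponent E} := by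
    rw [← Ideal.span_singleton_pow, ← hϖ.maximalIdeal_eq]
    exact IsDiscreteValuationRing.eq_maximalIdeal_pow_multiplicity hne
  -- The different is `D⁻¹` and is generated by `ϖ ^ d`; inverting shows that the trace dual `D` is
  -- generated by `ϖ ^ (-d)`, hence is a ball.
  rw [hpow, FractionalIdeal.coeIdeal_span_singleton, eq_comm, inv_eq_iff_eq_inv,
    FractionalIdeal.spanSingleton_inv] at hdiff
  have hpos : 0 < ‖(ϖ : E)‖ ^ differentExponent E := pow_pos (norm_irreducible_pos hϖ) _
  have hne0 : (ϖ : E) ^ differentExponent E ≠ 0 := by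
    rw [← norm_pos_iff, norm_pow]
    exact hpos
  have hmem : x ∈ D ↔ ‖x‖ ≤ (‖(ϖ : E)‖ ^ differentExponent E)⁻¹ := by
    rw [hdiff, FractionalIdeal.mem_spanSingleton, map_pow]
    change (∃ z : Valued.integer E, (z : E) * ((ϖ : E) ^ differentExponent E)⁻¹ = x) ↔ _
    rw [← norm_pow]
    constructor
    · rintro ⟨z, rfl⟩
      rw [norm_mul, norm_inv]
      exact mul_le_of_le_one_left (inv_nonneg.mpr (norm_nonneg _)) (norm_le_one_of_integer z)
    · intro h
      refine ⟨⟨x * (ϖ : E) ^ differentExponent E, mem_integer_iff_norm_le_one.mpr ?_⟩, ?_⟩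
      · rw [norm_mul]
        exact (le_inv_mul_iff₀' (norm_pos_iff.mpr hne0)).mp (by simpa using h)
      · exact mul_inv_cancel_right₀ hne0 x
  have h10 : (1 : FractionalIdeal (nonZeroDivisors (Valued.integer E)) E) ≠ 0 := one_ne_zero
  rw [← hmem, hD, FractionalIdeal.mem_dual h10]
  constructor
  · intro h b hb
    obtain ⟨c, rfl⟩ := (FractionalIdeal.mem_one_iff _).mp hb
    exact ⟨⟨_, mem_integer_iff_norm_le_one.mpr (h c (norm_le_one_of_integer c))⟩, rfl⟩
  · intro h b hb
    obtain ⟨c, hc⟩ := h b ((FractionalIdeal.mem_one_iff _).mpr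
      ⟨⟨b, mem_integer_iff_norm_le_one.mpr hb⟩, rfl⟩)
    rw [← Algebra.traceForm_apply, ← hc]
    exact norm_le_one_of_integer c

variable [Algebra.IsAlgebraic k K]

theorem normalizedTrace_coe (x : E) :
    Algebra.normalizedTrace k K (x : K) = (degree E : k)⁻¹ * Algebra.trace k E x := by
  rw [Algebra.normalizedTrace_intermediateField,
    Algebra.normalizedTrace_eq_of_finiteDimensional_apply, smul_eq_mul, degree]

/-- The dual of the ring of integers of `E` with respect to the pairing `(a, x) ↦ T(a x)`. -/
def dualBall : Set E := {x | ∀ b : E, ‖b‖ ≤ 1 → ‖Algebra.normalizedTrace k K ((b * x : E) : K)‖ ≤ 1}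

/-- The radius `q ^ (d / m) ‖m‖`. -/
noncomputable def dualRadius : ℝ :=
  (residueCard E : ℝ) ^ ((differentExponent E : ℝ) / (degree E : ℝ)) * ‖(degree E : K)‖

theorem natCast_degree_ne_zero : (degree E : k) ≠ 0 := Nat.cast_ne_zero.mpr (degree_pos E).ne'

theorem norm_degree : ‖(degree E : K)‖ = ‖(degree E : k)‖ := by
  rw [← norm_algebraMap' K (degree E : k), map_natCast]

theorem dualRadius_pos (hk : IsNormalized k) : 0 < dualRadius E := by
  rw [dualRadius, norm_degree]
  have := one_lt_residueCard E hk
  have := norm_pos_iff.mpr (natCast_degree_ne_zero E)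
  positivity

/-- On `E` the normalized trace is `m⁻¹ Tr`, so the condition says that `m⁻¹ x` lies in the inverse
different. The relation `‖ϖ‖ ^ m = q⁻¹` turns the radius `‖ϖ‖ ^ (-d)` into `q ^ (d / m)`. -/
theorem mem_dualBall_iff (hk : IsNormalized k) (x : E) : x ∈ dualBall E ↔ ‖x‖ ≤ dualRadius E := by
  obtain ⟨ϖ, hϖ⟩ := IsDiscreteValuationRing.exists_irreducible (Valued.integer E)
  have hm := natCast_degree_ne_zero E
  have hm' : 0 < ‖(degree E : k)‖ := norm_pos_iff.mpr hm
  have hr : (‖(ϖ : E)‖ ^ differentExponent E)⁻¹ =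
      (residueCard E : ℝ) ^ ((differentExponent E : ℝ) / (degree E : ℝ)) := by
    have h0 : (degree E : ℝ) ≠ 0 := by exact_mod_cast (degree_pos E).ne'
    have h1 : (residueCard E : ℝ) = (‖(ϖ : E)‖ ^ (degree E : ℝ))⁻¹ := by
      rw [Real.rpow_natCast, norm_irreducible_pow_degree E hk hϖ, inv_inv]
    rw [h1, Real.inv_rpow (by positivity), ← Real.rpow_mul (norm_nonneg _),
      mul_div_cancel₀ _ h0, Real.rpow_natCast]
  have hx : x ∈ dualBall E ↔
      ∀ b : E, ‖b‖ ≤ 1 → ‖Algebra.trace k E (((degree E : k)⁻¹ • x) * b)‖ ≤ 1 := by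
    refine forall₂_congr fun b _ => ?_
    rw [normalizedTrace_coe, smul_mul_assoc, map_smul, smul_eq_mul, mul_comm b]
  rw [hx, forall_norm_trace_le_one_iff E hϖ, hr, dualRadius, norm_degree, norm_smul, norm_inv,
    inv_mul_le_iff₀' hm']

end Extension

/-! ### Duality between unit balls and dual balls, and surjectivity of normalized traces -/

section Duality

variable {k K : Type*} [NontriviallyNormedField k] [IsUltrametricDist k] [ProperSpace k]
  [CharZero k] [NormedField K] [NormedAlgebra k K] [IsUltrametricDist K] [Algebra.IsAlgebraic k K]
  (E : IntermediateField k K) [FiniteDimensional k E]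

theorem mul_mem_dualBall {E : IntermediateField k K} {b y : E} (hb : ‖b‖ ≤ 1)
    (hy : y ∈ dualBall E) : b * y ∈ dualBall E := by
  intro c hc
  rw [← mul_assoc]
  exact hy _ (by rw [norm_mul]; exact mul_le_one₀ hc (norm_nonneg _) hb)

theorem exists_mem_dualBall_ne_zero (hk : IsNormalized k) : ∃ y ∈ dualBall E, y ≠ 0 := by
  obtain ⟨c, hc0, hc⟩ := NormedField.exists_norm_lt k (dualRadius_pos E hk)
  refine ⟨algebraMap k E c, ?_, ?_⟩
  · rw [mem_dualBall_iff E hk, norm_algebraMap']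
    exact hc.le
  · rw [← norm_pos_iff, norm_algebraMap']
    exact hc0

/-- The dual ball is bounded and contains some `y ≠ 0`; if `‖a‖ > 1`, the elements `a ^ n * y` would
leave it. -/
theorem norm_le_one_of_mul_mem_dualBall (hk : IsNormalized k) {a : E}
    (h : ∀ y ∈ dualBall E, a * y ∈ dualBall E) : ‖a‖ ≤ 1 := by
  obtain ⟨y, hy, hy0⟩ := exists_mem_dualBall_ne_zero E hk
  have hn : ∀ n : ℕ, a ^ n * y ∈ dualBall E := by
    intro n
    induction n with
    | zero => simpa using hy
    | succ n ih => rw [pow_succ', mul_assoc]; exact h _ ih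
  by_contra! ha
  have hy0 : 0 < ‖y‖ := norm_pos_iff.mpr hy0
  obtain ⟨n, hlt⟩ := pow_unbounded_of_one_lt (dualRadius E / ‖y‖) ha
  have h1 := (mem_dualBall_iff E hk _).mp (hn n)
  rw [norm_mul, norm_pow] at h1
  rw [div_lt_iff₀ hy0] at hlt
  linarith

/-- Scaling by `c⁻¹` reduces to the bound `1`. Since the dual ball is stable under integers, the
bound then says that `c⁻¹ a` maps the dual ball into itself. -/
theorem forall_norm_normalizedTrace_le_iff (hk : IsNormalized k) (a : E) {c : k} (hc : c ≠ 0) :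
    (∀ y ∈ dualBall E, ‖Algebra.normalizedTrace k K ((a * y : E) : K)‖ ≤ ‖c‖) ↔ ‖a‖ ≤ ‖c‖ := by
  have hc' : 0 < ‖c‖ := norm_pos_iff.mpr hc
  have hnorm : ‖c⁻¹ • a‖ ≤ 1 ↔ ‖a‖ ≤ ‖c‖ := by
    rw [norm_smul, norm_inv, inv_mul_le_iff₀ hc', mul_one]
  have htr : ∀ y : E, ‖Algebra.normalizedTrace k K (((c⁻¹ • a) * y : E) : K)‖ ≤ 1 ↔
      ‖Algebra.normalizedTrace k K ((a * y : E) : K)‖ ≤ ‖c‖ := by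
    intro y
    have : (((c⁻¹ • a) * y : E) : K) = c⁻¹ • ((a * y : E) : K) := by
      rw [smul_mul_assoc, IntermediateField.coe_smul]
    rw [this, map_smul, norm_smul, norm_inv, inv_mul_le_iff₀ hc', mul_one]
  rw [← hnorm]
  constructor
  · intro h
    refine norm_le_one_of_mul_mem_dualBall E hk fun y hy b hb => ?_
    rw [mul_left_comm, htr]
    exact h _ (mul_mem_dualBall hb hy)
  · intro h y hy
    rw [← htr]
    exact hy _ h

variable {E}

theorem normalizedTrace_T (x : K) :
    Algebra.normalizedTrace k K (T E x : K) = Algebra.normalizedTrace k K x := by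
  rw [Algebra.normalizedTrace_intermediateField]
  exact Algebra.normalizedTrace_trans_apply k E K x

theorem T_coe (x : E) : T E (x : K) = x :=
  Algebra.normalizedTrace_algebraMap_apply_eq_self E K x

theorem T_mul (b : E) (x : K) : T E (b * x) = b * T E x := (T E).map_smul b x

theorem T_T {E E' : IntermediateField k K} (h : E ≤ E') (x : K) : T E (T E' x : K) = T E x := by
  let _ : Algebra E E' := (IntermediateField.inclusion h).toAlgebra
  have : IsScalarTower E E' K := IsScalarTower.of_algebraMap_eq fun _ => rfl
  have : Algebra.IsIntegral E E' := ⟨fun y => by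
    have := Algebra.IsIntegral.isIntegral (R := E) (y : K)
    exact (isIntegral_algebraMap_iff (algebraMap E' K).injective).mp this⟩
  have h1 := Algebra.normalizedTrace_algebraMap_apply E E' K (T E' x)
  exact h1.trans (Algebra.normalizedTrace_trans_apply E E' K x)

theorem normalizedTrace_mul_T (b : E) (x : K) :
    Algebra.normalizedTrace k K ((b * T E x : E) : K) = Algebra.normalizedTrace k K (b * x) := by
  rw [← T_mul, normalizedTrace_T]

theorem T_mem_dualBall {E' : IntermediateField k K} (h : E ≤ E') {y : E'} (hy : y ∈ dualBall E') :
    T E (y : K) ∈ dualBall E := by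
  intro b hb
  rw [normalizedTrace_mul_T]
  exact hy (IntermediateField.inclusion h b) hb

/-- The normalized trace maps the dual of the integers of `E'` onto that of `E`. -/
theorem exists_T_eq (hk : IsNormalized k) {E' : IntermediateField k K} [FiniteDimensional k E']
    (h : E ≤ E') {y : E} (hy : y ∈ dualBall E) : ∃ w ∈ dualBall E', T E (w : K) = y := by
  have hmulE' : ∀ (c : E) (w : E'), ‖c‖ ≤ 1 → w ∈ dualBall E' →
      IntermediateField.inclusion h c * w ∈ dualBall E' := fun c w hc hw => mul_mem_dualBall hc hw
  -- If some trace is at least as large as `y`, multiplying `w` by the integer `y / T E w` of `E`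
  -- hits `y`, by linearity of the trace over `E`.
  by_cases hmax : ∃ w ∈ dualBall E', T E (w : K) ≠ 0 ∧ ‖y‖ ≤ ‖T E (w : K)‖
  · obtain ⟨w, hw, h0, hle⟩ := hmax
    refine ⟨IntermediateField.inclusion h (y / T E (w : K)) * w, hmulE' _ _ ?_ hw, ?_⟩
    · rw [norm_div]
      exact div_le_one_of_le₀ hle (norm_nonneg _)
    · exact (T_mul (y / T E (w : K)) (w : K)).trans (div_mul_cancel₀ y h0)
  · push Not at hmax
    by_cases hy0 : y = 0
    · exact ⟨0, by intro b hb; simp, by simp [hy0]⟩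
    exfalso
    obtain ⟨ϖ, hϖ⟩ := IsDiscreteValuationRing.exists_irreducible (Valued.integer E)
    have hϖ0 := norm_irreducible_pos hϖ
    have hϖ1 := norm_irreducible_lt_one hϖ
    -- All traces are now strictly smaller than `y`, and the value group of `E` is discrete, so
    -- there is room for a factor `ϖ⁻¹`.
    have hsmall : ∀ w ∈ dualBall E', (ϖ : E)⁻¹ * T E (w : K) ∈ dualBall E := by
      intro w hw
      rw [mem_dualBall_iff E hk]
      refine le_trans ?_ ((mem_dualBall_iff E hk y).mp hy)
      by_cases h0 : T E (w : K) = 0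
      · rw [h0, mul_zero, norm_zero]; exact norm_nonneg _
      have hlt := hmax w hw h0
      obtain ⟨i, hi⟩ := exists_norm_eq_zpow hϖ h0
      obtain ⟨j, hj⟩ := exists_norm_eq_zpow hϖ hy0
      rw [hi, hj, zpow_lt_zpow_iff_right_of_lt_one₀ hϖ0 hϖ1] at hlt
      rw [norm_mul, norm_inv, hi, hj, ← zpow_neg_one, ← zpow_add₀ hϖ0.ne']
      exact (zpow_le_zpow_iff_right_of_lt_one₀ hϖ0 hϖ1).mpr (by omega)
    -- Moving `ϖ⁻¹` inside the trace shows that it preserves the dual ball of `E'`, which is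
    -- impossible for an element of norm above `1`.
    have hstab : ∀ w ∈ dualBall E',
        IntermediateField.inclusion h (ϖ : E)⁻¹ * w ∈ dualBall E' := by
      intro w hw b hb
      have h1 := hsmall _ (mul_mem_dualBall hb hw) 1 (by simp)
      rw [one_mul, normalizedTrace_mul_T] at h1
      rw [mul_left_comm]
      exact h1
    have h2 := norm_le_one_of_mul_mem_dualBall E' hk hstab
    have h3 : ‖(ϖ : E)⁻¹‖ ≤ 1 := h2
    rw [norm_inv] at h3
    exact absurd ((one_lt_inv₀ hϖ0).mpr hϖ1) (not_lt.mpr h3)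

end Duality

/-! ### The projective limit, the compact subgroup `S` and its characters -/

section Limit

variable {k K : Type*} [NontriviallyNormedField k] [IsUltrametricDist k] [ProperSpace k]
  [CharZero k] [NormedField K] [NormedAlgebra k K] [IsUltrametricDist K] [Algebra.IsAlgebraic k K]
  (F : ℕ → IntermediateField k K) [∀ n, FiniteDimensional k (F n)]

theorem continuous_T_coe (E E' : IntermediateField k K) [FiniteDimensional k E']
    [FiniteDimensional k E] : Continuous fun x : E' => T E (x : K) :=
  (((T E).restrictScalars k).comp (Algebra.linearMap E' K |>.restrictScalars k)
    ).continuous_of_finiteDimensional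

theorem isClosed_KBar : IsClosed (KBar F : Set (∀ n, F n)) := by
  have : (KBar F : Set (∀ n, F n)) =
      ⋂ (n : ℕ) (ν : ℕ) (_ : n ≤ ν), {x | x n = T (F n) (x ν : K)} := by
    ext x
    simp [KBar]
  rw [this]
  refine isClosed_iInter fun n => isClosed_iInter fun ν => isClosed_iInter fun _ => ?_
  exact isClosed_eq (continuous_apply n) ((continuous_T_coe (F n) (F ν)).comp (continuous_apply ν))

instance polishSpace_KBar : PolishSpace (KBar F) := by
  have : ∀ n, ProperSpace (F n) := fun n => FiniteDimensional.proper k (F n)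
  have : ∀ n, PolishSpace (F n) := fun n => inferInstance
  have : PolishSpace (∀ n, F n) := inferInstance
  exact (isClosed_KBar F).isClosedEmbedding_subtypeVal.polishSpace

theorem continuous_coord (n : ℕ) : Continuous fun x : KBar F => x.1 n :=
  (continuous_apply n).comp continuous_subtype_val

variable {F} in
theorem T_coord (x : KBar F) {n ν : ℕ} (h : n ≤ ν) : T (F n) (x.1 ν : K) = x.1 n :=
  (x.2 n ν h).symm

theorem continuous_pairing (n : ℕ) (a : F n) : Continuous (pairing F n a) := by
  have h1 : Continuous fun y : F n => Algebra.normalizedTrace k K (y : K) :=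
    ((Algebra.normalizedTrace k K).comp
      (Algebra.linearMap (F n) K |>.restrictScalars k)).continuous_of_finiteDimensional
  have h2 : Continuous fun x : KBar F => a * x.1 n := (continuous_coord F n).const_mul a
  have h3 : pairing F n a =
      fun x : KBar F => Algebra.normalizedTrace k K ((a * x.1 n : F n) : K) := rfl
  rw [h3]
  exact h1.comp h2

variable {F}

/-- The projection formula for the trace makes the pairing independent of the level at which `a` is
viewed. -/
theorem pairing_eq_of_le {n ν : ℕ} (h : n ≤ ν) (hF : F n ≤ F ν) (a : F n) (x : KBar F) :
    pairing F ν (IntermediateField.inclusion hF a) x = pairing F n a x := by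
  rw [pairing, pairing, ← T_coord x h]
  exact (normalizedTrace_mul_T a (x.1 ν : K)).symm

theorem pairing_add_right (n : ℕ) (a : F n) (x y : KBar F) :
    pairing F n a (x + y) = pairing F n a x + pairing F n a y := by
  simp [pairing, mul_add]

theorem pairing_add_left (n : ℕ) (a b : F n) (x : KBar F) :
    pairing F n (a + b) x = pairing F n a x + pairing F n b x := by
  simp [pairing, add_mul]

theorem pairing_zero_left (n : ℕ) (x : KBar F) : pairing F n 0 x = 0 := by
  simp [pairing]

variable (F)

/-- The set `S` as a subgroup. -/
def subgroupS : AddSubgroup (KBar F) where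
  carrier := {x | ∀ n, x.1 n ∈ dualBall (F n)}
  zero_mem' := by intro n b _; simp
  add_mem' := by
    intro x y hx hy n b hb
    have := IsUltrametricDist.norm_add_le_max
      (Algebra.normalizedTrace k K ((b * x.1 n : F n) : K))
      (Algebra.normalizedTrace k K ((b * y.1 n : F n) : K))
    rw [← map_add] at this
    refine le_trans (le_of_eq ?_) (this.trans (max_le (hx n b hb) (hy n b hb)))
    simp [mul_add]
  neg_mem' := by
    intro x hx n b hb
    have := hx n b hb
    rw [← norm_neg, ← map_neg] at this
    simpa using this

variable {F}

theorem coe_subgroupS (hk : IsNormalized k) : (subgroupS F : Set (KBar F)) = S F := by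
  ext x
  exact forall_congr' fun n => mem_dualBall_iff (F n) hk (x.1 n)

theorem mem_S_iff (hk : IsNormalized k) {x : KBar F} : x ∈ S F ↔ x ∈ subgroupS F := by
  rw [← coe_subgroupS hk, SetLike.mem_coe]

theorem isCompact_S : IsCompact (S F) := by
  have hp : ∀ n, ProperSpace (F n) := fun n => FiniteDimensional.proper k (F n)
  have h1 : IsCompact (Set.univ.pi fun n => Metric.closedBall (0 : F n) (dualRadius (F n))) :=
    isCompact_univ_pi fun n => isCompact_closedBall _ _
  have h2 := (isClosed_KBar F).isClosedEmbedding_subtypeVal.isCompact_preimage h1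
  convert! h2 using 1
  ext x
  simp only [Set.mem_preimage, Set.mem_univ_pi, mem_closedBall_zero_iff]
  rfl

/-- The projection of `S` to `F n` is the whole dual ball. -/
theorem exists_mem_subgroupS_coord_eq (hk : IsNormalized k) (hF : Monotone F) {n : ℕ} {y : F n}
    (hy : y ∈ dualBall (F n)) : ∃ x ∈ subgroupS F, x.1 n = y := by
  -- Membership is placed under the existential so that `choose` yields a total lifting function;
  -- its value off the dual ball is irrelevant.
  have hstep : ∀ (j : ℕ) (z : F (n + j)), ∃ w : F (n + (j + 1)), z ∈ dualBall (F (n + j)) →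
      w ∈ dualBall (F (n + (j + 1))) ∧ T (F (n + j)) (w : K) = z := by
    intro j z
    by_cases hz : z ∈ dualBall (F (n + j))
    · obtain ⟨w, hw⟩ := exists_T_eq hk (hF (show n + j ≤ n + (j + 1) by omega)) hz
      exact ⟨w, fun _ => hw⟩
    · exact ⟨0, fun h => absurd h hz⟩
  choose next hnext using hstep
  let z : ∀ j, F (n + j) := fun j => Nat.rec (motive := fun j => F (n + j)) y next j
  have hz : ∀ j, z j ∈ dualBall (F (n + j)) := by
    intro j
    induction j with
    | zero => exact hy
    | succ j ih => exact (hnext j _ ih).1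
  have hzT : ∀ j, T (F (n + j)) (z (j + 1) : K) = z j := fun j => (hnext j _ (hz j)).2
  have hTz : ∀ i j j', j ≤ j' → i ≤ n + j → T (F i) (z j' : K) = T (F i) (z j : K) := by
    intro i j j' hj hi
    induction j', hj using Nat.le_induction with
    | base => rfl
    | succ j' hj ih => rw [← ih, ← hzT j', T_T (hF (by omega))]
  -- As `z i` lives in `F (n + i)`, which contains `F i`, one formula covers the levels both below
  -- and above `n`.
  refine ⟨⟨fun i => T (F i) (z i : K), ?_⟩, ?_, ?_⟩
  · intro i ν h
    change T (F i) (z i : K) = T (F i) (T (F ν) (z ν : K) : K)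
    rw [T_T (hF h)]
    exact (hTz i i ν h (by omega)).symm
  · intro i
    exact T_mem_dualBall (hF (by omega)) (hz i)
  · change T (F n) (z n : K) = y
    rw [hTz n 0 n (by omega) le_rfl]
    exact T_coe (E := F n) y

theorem norm_pairing_le (hk : IsNormalized k) {n : ℕ} {a : F n} {c : k} (h : ‖a‖ ≤ ‖c‖)
    {x : KBar F} (hx : x ∈ subgroupS F) : ‖pairing F n a x‖ ≤ ‖c‖ := by
  by_cases hc : c = 0
  · have : a = 0 := by simpa [hc] using h
    simp [this, pairing_zero_left]
  · exact (forall_norm_normalizedTrace_le_iff (F n) hk a hc).mpr h _ (hx n)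

theorem exists_lt_norm_pairing (hk : IsNormalized k) (hF : Monotone F) {n : ℕ} {a : F n} {c : k}
    (hc : c ≠ 0) (h : ‖c‖ < ‖a‖) : ∃ x ∈ subgroupS F, ‖c‖ < ‖pairing F n a x‖ := by
  have := mt (forall_norm_normalizedTrace_le_iff (F n) hk a hc).mp (not_le.mpr h)
  push Not at this
  obtain ⟨y, hy, hlt⟩ := this
  obtain ⟨x, hx, rfl⟩ := exists_mem_subgroupS_coord_eq hk hF hy
  exact ⟨x, hx, hlt⟩

/-- The character of `S` defined by `a` is nontrivial if `‖a‖ > 1`. -/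
theorem exists_character_pairing_ne_one (hk : IsNormalized k) (hF : Monotone F)
    {χ : AddChar k Circle} (hχ : IsRankZero χ) {n : ℕ} {a : F n} (h : 1 < ‖a‖) :
    ∃ x ∈ subgroupS F, χ (pairing F n a x) ≠ 1 := by
  obtain ⟨x, hx, hlt⟩ := exists_lt_norm_pairing hk hF (one_ne_zero (α := k)) (by simpa using h)
  rw [norm_one] at hlt
  have := mt (hχ.2 (pairing F n a x)).mp (not_le.mpr hlt)
  push Not at this
  obtain ⟨t, ht, hne⟩ := this
  have hx0 : pairing F n a x ≠ 0 := norm_pos_iff.mp (one_pos.trans hlt)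
  -- The value at `x` may itself lie in the kernel of `χ`. Some `t` of no larger norm does not, and
  -- the integral scalar `c` moves the value to `t`; the rescaled coordinate is then lifted back to
  -- `S`.
  set c := t / pairing F n a x with hc
  have hc1 : ‖algebraMap k (F n) c‖ ≤ 1 := by
    rw [norm_algebraMap', hc, norm_div]
    exact div_le_one_of_le₀ ht (norm_nonneg _)
  obtain ⟨w, hw, hwn⟩ := exists_mem_subgroupS_coord_eq hk hF (mul_mem_dualBall hc1 (hx n))
  refine ⟨w, hw, ?_⟩
  have : pairing F n a w = c * pairing F n a x := by
    rw [pairing, pairing, hwn, ← smul_eq_mul c, ← map_smul, Algebra.smul_def]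
    exact congrArg _ (mul_left_comm _ _ _)
  rw [this, hc, div_mul_cancel₀ t hx0]
  exact hne

theorem character_pairing_eq_one (hk : IsNormalized k)
    {χ : AddChar k Circle} (hχ : IsRankZero χ) {n : ℕ} {a : F n} (h : ‖a‖ ≤ 1)
    {x : KBar F} (hx : x ∈ subgroupS F) : χ (pairing F n a x) = 1 :=
  (hχ.2 1).mpr (by simp) _ (norm_pairing_le hk (by simpa using h) hx)

end Limit

/-! ### Uniqueness: characters determine the measure -/

section Uniqueness

variable {k K : Type*} [NontriviallyNormedField k] [CharZero k] [NormedField K]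
  [NormedAlgebra k K] [Algebra.IsAlgebraic k K] {F : ℕ → IntermediateField k K}

open BoundedContinuousFunction

/-- The characters `x ↦ χ ⟨a, x⟩` as bounded continuous functions. -/
def characters (F : ℕ → IntermediateField k K) (χ : AddChar k Circle) : Set (KBar F →ᵇ ℂ) :=
  {g | ∃ (n : ℕ) (a : F n), ∀ x, g x = χ (pairing F n a x)}

theorem star_mem_characters {χ : AddChar k Circle} {g : KBar F →ᵇ ℂ} (hg : g ∈ characters F χ) :
    star g ∈ characters F χ := by
  obtain ⟨n, a, h⟩ := hg
  refine ⟨n, -a, fun x => ?_⟩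
  have h0 : pairing F n (-a) x = -pairing F n a x := by simp [pairing]
  rw [h0, AddChar.map_neg_eq_inv, Circle.coe_inv_eq_conj, ← h]
  rfl

/-- The star subalgebra spanned by the characters. -/
noncomputable def charactersSubalgebra (F : ℕ → IntermediateField k K) (χ : AddChar k Circle) :
    StarSubalgebra ℂ (KBar F →ᵇ ℂ) where
  toSubalgebra := Algebra.adjoin ℂ (characters F χ)
  star_mem' := by
    intro g hg
    induction hg using Algebra.adjoin_induction with
    | mem g hg => exact Algebra.subset_adjoin (star_mem_characters hg)
    | algebraMap r =>
      rw [← algebraMap_star_comm]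
      exact Subalgebra.algebraMap_mem _ _
    | add g g' _ _ h h' => rw [star_add]; exact Subalgebra.add_mem _ h h'
    | mul g g' _ _ h h' => rw [star_mul]; exact Subalgebra.mul_mem _ h' h

variable [IsUltrametricDist k] [ProperSpace k] [IsUltrametricDist K]
  [∀ n, FiniteDimensional k (F n)]

theorem exists_mem_characters {χ : AddChar k Circle} (hχ : Continuous χ) (n : ℕ) (a : F n) :
    ∃ g ∈ characters F χ, ∀ x, g x = χ (pairing F n a x) := by
  have hc : Continuous fun x : KBar F => (χ (pairing F n a x) : ℂ) :=
    continuous_subtype_val.comp (hχ.comp (continuous_pairing F n a))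
  exact ⟨BoundedContinuousFunction.ofNormedAddCommGroup _ hc 1
    fun x => (Circle.norm_coe _).le,
    ⟨n, a, fun _ => rfl⟩, fun _ => rfl⟩

/-- The submonoid of characters. -/
def charactersSubmonoid (hF : Monotone F) (χ : AddChar k Circle) : Submonoid (KBar F →ᵇ ℂ) where
  carrier := characters F χ
  one_mem' := ⟨0, 0, fun x => by simp [pairing_zero_left]⟩
  mul_mem' := by
    rintro g g' ⟨n, a, h⟩ ⟨n', a', h'⟩
    refine ⟨max n n', IntermediateField.inclusion (hF (le_max_left n n')) a +
      IntermediateField.inclusion (hF (le_max_right n n')) a', fun x => ?_⟩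
    rw [pairing_add_left, pairing_eq_of_le (le_max_left n n'), pairing_eq_of_le (le_max_right n n'),
      AddChar.map_add_eq_mul, BoundedContinuousFunction.mul_apply, h, h', Circle.coe_mul]

/-- Products of characters are characters, so the generated algebra is already their linear span.
Equality of integrals then only needs checking on characters. -/
theorem mem_span_of_mem_charactersSubalgebra (hF : Monotone F) {χ : AddChar k Circle}
    {g : KBar F →ᵇ ℂ} (hg : g ∈ charactersSubalgebra F χ) :
    g ∈ Submodule.span ℂ (characters F χ) := by
  have h : g ∈ Subalgebra.toSubmodule (Algebra.adjoin ℂ (characters F χ)) := hg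
  rw [Algebra.adjoin_eq_span] at h
  have h2 : Submonoid.closure (characters F χ) = charactersSubmonoid hF χ :=
    Submonoid.closure_eq (charactersSubmonoid hF χ)
  rw [h2] at h
  exact h

/-- With `χ t ≠ 1` and `x n ≠ y n`, the choice `a = t / (x n - y n)` makes the pairings differ by
exactly `t`. -/
theorem separatesPoints_charactersSubalgebra {χ : AddChar k Circle} (hχ : IsRankZero χ) :
    ((charactersSubalgebra F χ).map (toContinuousMapStarₐ ℂ)).SeparatesPoints := by
  intro x y hxy
  obtain ⟨t, ht⟩ : ∃ t : k, χ t ≠ 1 := by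
    obtain ⟨c, hc⟩ := NormedField.exists_one_lt_norm k
    have := mt (hχ.2 c).mp (not_le.mpr hc)
    push Not at this
    obtain ⟨t, -, ht⟩ := this
    exact ⟨t, ht⟩
  obtain ⟨n, hn⟩ : ∃ n, x.1 n ≠ y.1 n := by
    by_contra! h
    exact hxy (Subtype.ext (funext h))
  have hz : x.1 n - y.1 n ≠ 0 := sub_ne_zero.mpr hn
  obtain ⟨g, hg, hgx⟩ := exists_mem_characters (F := F) hχ.1 n
    (algebraMap k (F n) t * (x.1 n - y.1 n)⁻¹)
  refine ⟨g, ⟨_, ⟨g, Algebra.subset_adjoin hg, rfl⟩, rfl⟩, ?_⟩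
  intro heq
  have heq : g x = g y := heq
  rw [hgx, hgx, Circle.coe_inj] at heq
  apply ht
  have h1 : pairing F n (algebraMap k (F n) t * (x.1 n - y.1 n)⁻¹) x =
      t + pairing F n (algebraMap k (F n) t * (x.1 n - y.1 n)⁻¹) y := by
    have h2 : ((algebraMap k (F n) t * (x.1 n - y.1 n)⁻¹ : F n) : K) * (x.1 n : K) =
        algebraMap k K t +
          ((algebraMap k (F n) t * (x.1 n - y.1 n)⁻¹ : F n) : K) * (y.1 n : K) := by
      have h3 : (algebraMap k (F n) t * (x.1 n - y.1 n)⁻¹) * x.1 n =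
          algebraMap k (F n) t + (algebraMap k (F n) t * (x.1 n - y.1 n)⁻¹) * y.1 n := by
        field_simp
        ring
      exact congrArg Subtype.val h3
    rw [pairing, h2, map_add, Algebra.normalizedTrace_algebraMap_apply_eq_self, pairing]
  rw [h1, AddChar.map_add_eq_mul] at heq
  exact mul_eq_right.mp heq

theorem IsGaussian.unique (hF : Monotone F) {χ : AddChar k Circle} (hχ : IsRankZero χ)
    {μ ν : Measure (KBar F)} (hμ : IsGaussian F χ μ) (hν : IsGaussian F χ ν) : ν = μ := by
  have := hμ.prob
  have := hν.prob
  refine ext_of_forall_mem_subalgebra_integral_eq_of_polish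
    (separatesPoints_charactersSubalgebra hχ) fun g hg => ?_
  have hspan := mem_span_of_mem_charactersSubalgebra hF hg
  clear hg
  induction hspan using Submodule.span_induction with
  | mem g hg =>
    obtain ⟨n, a, h⟩ := hg
    simp only [h, hμ.fourier, hν.fourier]
  | zero => simp
  | add g g' _ _ h h' =>
    simp only [BoundedContinuousFunction.add_apply]
    rw [integral_add (g.integrable ν) (g'.integrable ν),
      integral_add (g.integrable μ) (g'.integrable μ), h, h']
  | smul c g _ h =>
    simp only [BoundedContinuousFunction.smul_apply]
    rw [integral_smul, integral_smul, h]

end Uniqueness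

/-- A compact subgroup carries an invariant probability measure charging its open subsets. -/
theorem exists_invariant_probability_of_isCompact {G : Type*} [AddCommGroup G] [TopologicalSpace G]
    [IsTopologicalAddGroup G] [MeasurableSpace G] [BorelSpace G] [T2Space G] (H : AddSubgroup G)
    (hH : IsCompact (H : Set G)) :
    ∃ μ : Measure G, IsProbabilityMeasure μ ∧ μ (H : Set G)ᶜ = 0 ∧
      (∀ y ∈ H, μ.map (fun x => x + y) = μ) ∧
      ∀ U, IsOpen U → (U ∩ H).Nonempty → μ U ≠ 0 := by
  have : CompactSpace H := isCompact_iff_compactSpace.mp hH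
  let ν : Measure H := Measure.addHaarMeasure ⊤
  have hν : IsProbabilityMeasure ν := ⟨Measure.addHaarMeasure_self⟩
  have hm : Measurable (Subtype.val : H → G) := measurable_subtype_coe
  refine ⟨ν.map Subtype.val, Measure.isProbabilityMeasure_map hm.aemeasurable, ?_, ?_, ?_⟩
  · rw [Measure.map_apply hm hH.isClosed.measurableSet.compl]
    convert measure_empty (μ := ν)
    ext x
    simp
  · intro y hy
    have h1 : Measurable fun x : G => x + y := (continuous_id.add_const y).measurable
    have h2 : Measurable fun x : H => x + ⟨y, hy⟩ := (continuous_id.add_const _).measurable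
    rw [Measure.map_map h1 hm]
    have h3 : (fun x : G => x + y) ∘ (Subtype.val : H → G) =
        Subtype.val ∘ fun x : H => x + ⟨y, hy⟩ := rfl
    rw [h3, ← Measure.map_map hm h2, map_add_right_eq_self]
  · rintro U hU ⟨x, hxU, hxH⟩
    rw [Measure.map_apply hm hU.measurableSet]
    exact (hU.preimage continuous_subtype_val).measure_ne_zero ν ⟨⟨x, hxH⟩, hxU⟩

/-! ### Haar measure of `S`: Fourier transform, singular shifts, essential suprema -/

section Existence

variable {k K : Type*} [NontriviallyNormedField k] [IsUltrametricDist k] [ProperSpace k]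
  [CharZero k] [NormedField K] [NormedAlgebra k K] [IsUltrametricDist K] [Algebra.IsAlgebraic k K]
  {F : ℕ → IntermediateField k K} [∀ n, FiniteDimensional k (F n)]

theorem innerRegular_of_isFiniteMeasure {X : Type*} [TopologicalSpace X] [PolishSpace X]
    [MeasurableSpace X] [BorelSpace X] (μ : Measure X) [IsFiniteMeasure μ] : μ.InnerRegular := by
  constructor
  intro s hs r hr
  obtain ⟨C, hC, hC2, hr2⟩ := innerRegular_isCompact_isClosed_measurableSet_of_finite μ hs r hr
  exact ⟨C, hC, hC2.1, hr2⟩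

/-- Shifting by `y` multiplies the integral by `χ ⟨a, y⟩ ≠ 1` but leaves it unchanged. -/
theorem integral_character_pairing_eq_zero {χ : AddChar k Circle} (hχ : Continuous χ)
    {μ : Measure (KBar F)} {n : ℕ} {a : F n} {y : KBar F} (hinv : μ.map (fun x => x + y) = μ)
    (hy : χ (pairing F n a y) ≠ 1) : ∫ x, (χ (pairing F n a x) : ℂ) ∂μ = 0 := by
  have hc : Continuous fun x : KBar F => (χ (pairing F n a x) : ℂ) :=
    continuous_subtype_val.comp (hχ.comp (continuous_pairing F n a))
  have h1 : Measurable fun x : KBar F => x + y := (continuous_id.add_const y).measurable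
  have h : ∫ x, (χ (pairing F n a x) : ℂ) ∂μ =
      (∫ x, (χ (pairing F n a x) : ℂ) ∂μ) * (χ (pairing F n a y) : ℂ) := by
    conv_lhs => rw [← hinv]
    rw [integral_map h1.aemeasurable hc.aestronglyMeasurable, ← integral_mul_const]
    congr with x
    rw [pairing_add_right, AddChar.map_add_eq_mul, Circle.coe_mul]
  by_contra h0
  have h2 := mul_left_cancel₀ h0 (h.symm.trans (mul_one _).symm)
  exact hy (Circle.ext h2)

theorem isGaussian_of_invariant (hk : IsNormalized k) (hF : Monotone F) {χ : AddChar k Circle}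
    (hχ : IsRankZero χ) {μ : Measure (KBar F)} [IsProbabilityMeasure μ] (hS : μ (S F)ᶜ = 0)
    (hinv : ∀ y ∈ S F, μ.map (fun x => x + y) = μ) : IsGaussian F χ μ where
  prob := inferInstance
  radon := innerRegular_of_isFiniteMeasure μ
  fourier n a := by
    by_cases ha : ‖a‖ ≤ 1
    · have h1 : Omega (a : K) = 1 := Set.indicator_of_mem (s := {a : K | ‖a‖ ≤ 1}) ha 1
      have h2 : ∀ᵐ x ∂μ, (χ (pairing F n a x) : ℂ) = 1 := by
        filter_upwards [compl_mem_ae_iff.mpr hS] with x hx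
        rw [compl_compl, mem_S_iff hk] at hx
        rw [character_pairing_eq_one hk hχ ha hx, Circle.coe_one]
      rw [h1, integral_congr_ae h2]
      simp
    · have h1 : Omega (a : K) = 0 := Set.indicator_of_notMem (s := {a : K | ‖a‖ ≤ 1}) ha 1
      obtain ⟨y, hy, hne⟩ := exists_character_pairing_ne_one hk hF hχ (not_le.mp ha)
      rw [h1]
      exact integral_character_pairing_eq_zero hχ.1 (hinv y ((mem_S_iff hk).mpr hy)) hne

theorem mutuallySingular_map_add (hk : IsNormalized k) {μ : Measure (KBar F)} (hS : μ (S F)ᶜ = 0)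
    {y : KBar F} (hy : y ∉ S F) : (μ.map (fun x => x + y)).MutuallySingular μ := by
  have hSm : MeasurableSet (S F) := isCompact_S.isClosed.measurableSet
  have h1 : Measurable fun x : KBar F => x + y := (continuous_id.add_const y).measurable
  refine ⟨S F, hSm, ?_, hS⟩
  rw [Measure.map_apply h1 hSm]
  refine measure_mono_null (t := (S F)ᶜ) (fun x hx hxS => hy ?_) hS
  rw [Set.mem_preimage, mem_S_iff hk] at hx
  rw [mem_S_iff hk] at hxS ⊢
  exact (AddSubgroup.add_mem_cancel_left (subgroupS F) hxS).mp hx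

theorem exists_normalizedAbs_eq_zpow (hk : IsNormalized k) (E : IntermediateField k K)
    [FiniteDimensional k E] {a : E} (ha : a ≠ 0) :
    ∃ N : ℤ, normalizedAbs E a = (residueCard E : ℝ) ^ N := by
  obtain ⟨ϖ, hϖ⟩ := IsDiscreteValuationRing.exists_irreducible (Valued.integer E)
  obtain ⟨i, hi⟩ := exists_norm_eq_zpow hϖ ha
  refine ⟨-i, ?_⟩
  have h := norm_irreducible_pow_degree E hk hϖ
  rw [normalizedAbs, norm_algebraNorm, hi, ← zpow_natCast, zpow_comm, zpow_natCast]
  change (‖(ϖ : E)‖ ^ degree E) ^ i = _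
  rw [h, inv_zpow, zpow_neg]

/-- Since `m = e f` and the residue field of `E` has `q ^ f` elements, this is the `f`-th root of
the hypothesis. -/
theorem norm_pow_ramificationIndex (hk : IsNormalized k) (E : IntermediateField k K)
    [FiniteDimensional k E] {a : E} {N : ℤ} (h : normalizedAbs E a = (residueCard E : ℝ) ^ N) :
    ‖a‖ ^ ramificationIndex E = (residueCard k : ℝ) ^ N := by
  have hq := one_lt_residueCard_base hk
  have hf : (Valued.maximalIdeal E).inertiaDeg (Valued.integer k) ≠ 0 := by
    intro h0
    have := ramificationIndex_mul_inertiaDeg E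
    rw [h0, mul_zero] at this
    exact (degree_pos E).ne this
  have h1 : ‖a‖ ^ degree E = (residueCard E : ℝ) ^ N := by
    rw [← h, normalizedAbs, norm_algebraNorm, degree]
  rw [← ramificationIndex_mul_inertiaDeg, pow_mul, residueCard_pow_inertiaDeg, Nat.cast_pow,
    ← zpow_natCast (residueCard k : ℝ), zpow_comm, zpow_natCast] at h1
  exact (pow_left_inj₀ (by positivity) (by positivity) hf).mp h1

theorem ramificationIndex_pos (E : IntermediateField k K) [FiniteDimensional k E] :
    0 < ramificationIndex E :=
  Nat.pos_of_mul_pos_right (ramificationIndex_mul_inertiaDeg E ▸ degree_pos E)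

/-- Comparison of `‖a‖` with the integral powers of `q`. -/
theorem norm_le_zpow_iff (hk : IsNormalized k) (E : IntermediateField k K)
    [FiniteDimensional k E] {a : E} {N : ℤ} (h : normalizedAbs E a = (residueCard E : ℝ) ^ N)
    (j : ℤ) : ‖a‖ ≤ (residueCard k : ℝ) ^ j ↔ -⌊-(N : ℚ) / (ramificationIndex E : ℚ)⌋ ≤ j := by
  have hq : (1 : ℝ) < residueCard k := by exact_mod_cast one_lt_residueCard_base hk
  have he := ramificationIndex_pos E
  have he' : (0 : ℚ) < ramificationIndex E := by exact_mod_cast he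
  rw [← pow_le_pow_iff_left₀ (norm_nonneg a) (by positivity) he.ne',
    norm_pow_ramificationIndex hk E h, ← zpow_natCast, ← zpow_mul, zpow_le_zpow_iff_right₀ hq,
    neg_le, Int.le_floor, le_div_iff₀ he']
  constructor
  · intro h
    have : (N : ℚ) ≤ j * ramificationIndex E := by exact_mod_cast h
    push_cast
    linarith
  · intro h
    push_cast at h
    have : (N : ℚ) ≤ j * ramificationIndex E := by linarith
    exact_mod_cast this

/-- The value is `‖a‖` rounded up to the value group of `k`. It bounds the pairing on `S`, and it is
reached on an open set meeting `S`. -/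
theorem essSup_enorm_pairing (hk : IsNormalized k) (hF : Monotone F) {μ : Measure (KBar F)}
    (hS : μ (S F)ᶜ = 0) (hpos : ∀ U, IsOpen U → (U ∩ S F).Nonempty → μ U ≠ 0) {n : ℕ} {a : F n}
    {N : ℤ} (h : normalizedAbs (F n) a = (residueCard (F n) : ℝ) ^ N) :
    essSup (fun x => ‖pairing F n a x‖ₑ) μ =
      ENNReal.ofReal ((residueCard k : ℝ) ^ (-⌊-(N : ℚ) / (ramificationIndex (F n) : ℚ)⌋)) := by
  have hq : (1 : ℝ) < residueCard k := by exact_mod_cast one_lt_residueCard_base hk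
  have hle := norm_le_zpow_iff hk (F n) h
  set j := -⌊-(N : ℚ) / (ramificationIndex (F n) : ℚ)⌋
  obtain ⟨ϖ, hϖ, hϖn⟩ := id hk
  have hc : ∀ i : ℤ, ‖(ϖ : k) ^ (-i)‖ = (residueCard k : ℝ) ^ i := by
    intro i
    rw [norm_zpow, hϖn, inv_zpow, zpow_neg, inv_inv]
  apply le_antisymm
  · refine essSup_le_of_ae_le _ ?_
    filter_upwards [compl_mem_ae_iff.mpr hS] with x hx
    rw [compl_compl, mem_S_iff hk] at hx
    rw [← ofReal_norm, ← hc j]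
    exact ENNReal.ofReal_le_ofReal (norm_pairing_le hk (by rw [hc, hle]) hx)
  · by_contra! hlt
    have hae := ae_lt_of_essSup_lt hlt
    have hc0 : (ϖ : k) ^ (-(j - 1)) ≠ 0 := by
      rw [← norm_pos_iff, hc]
      positivity
    -- By minimality of `j`, the preceding value `q ^ (j - 1)` is below `‖a‖`. Pairings lie in `k`,
    -- so a nonzero one exceeding `q ^ (j - 1)` is at least `q ^ j`.
    have hlt' : ‖(ϖ : k) ^ (-(j - 1))‖ < ‖a‖ := by
      rw [hc, ← not_le, hle]
      omega
    obtain ⟨x, hx, hxlt⟩ := exists_lt_norm_pairing hk hF hc0 hlt'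
    refine hpos {x | ‖(ϖ : k) ^ (-(j - 1))‖ < ‖pairing F n a x‖}
      (isOpen_lt continuous_const (continuous_pairing F n a).norm)
      ⟨x, hxlt, (mem_S_iff hk).mpr hx⟩ (measure_mono_null ?_ hae)
    intro y hy
    simp only [Set.mem_ofPred_eq, hc] at hy
    have hy0 : pairing F n a y ≠ 0 := norm_pos_iff.mp (lt_trans (by positivity) hy)
    obtain ⟨i, hi⟩ := exists_norm_eq_zpow hϖ hy0
    rw [hϖn, inv_zpow, ← zpow_neg] at hi
    rw [hi, zpow_lt_zpow_iff_right₀ hq] at hy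
    simp only [Set.mem_compl_iff, Set.mem_ofPred_eq, not_lt]
    rw [← ofReal_norm, hi]
    exact ENNReal.ofReal_le_ofReal (zpow_le_zpow_right₀ hq.le (by omega))

end Existence

/-! ### Density of cylindrical test functions -/

section TestFunctions

variable {k K : Type*} [NontriviallyNormedField k] [IsUltrametricDist k] [ProperSpace k]
  [CharZero k] [NormedField K] [NormedAlgebra k K] [IsUltrametricDist K] [Algebra.IsAlgebraic k K]
  {F : ℕ → IntermediateField k K} [∀ n, FiniteDimensional k (F n)]

theorem memLp_of_mem_testFunctions {μ : Measure (KBar F)} [IsFiniteMeasure μ] {f : KBar F → ℂ}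
    (hf : f ∈ testFunctions F) (s : ℝ≥0∞) : MemLp f s μ := by
  obtain ⟨n, φ, hφ, hφc, rfl⟩ := hf
  have hc : Continuous φ := hφ.continuous
  obtain ⟨C, hC⟩ := hφc.exists_bound_of_continuous hc
  exact MemLp.of_bound (hc.comp (continuous_coord F n)).aestronglyMeasurable C
    (Filter.Eventually.of_forall fun x => hC _)

/-- Restrictions to `S` of locally constant cylindrical functions. -/
def cylinderFunctions (F : ℕ → IntermediateField k K) [∀ n, FiniteDimensional k (F n)] :
    StarSubalgebra ℂ C(S F, ℂ) where
  carrier := {f | ∃ (n : ℕ) (φ : F n → ℂ), IsLocallyConstant φ ∧ ∀ x, f x = φ (x.1.1 n)}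
  algebraMap_mem' r := ⟨0, fun _ => r, IsLocallyConstant.const r, fun _ => rfl⟩
  star_mem' := by
    rintro f ⟨n, φ, hφ, h⟩
    exact ⟨n, fun y => star (φ y), hφ.comp star, fun x => by rw [ContinuousMap.star_apply, h]⟩
  add_mem' := by
    rintro f g ⟨n, φ, hφ, h⟩ ⟨n', ψ, hψ, h'⟩
    have hn := le_max_left n n'
    have hn' := le_max_right n n'
    -- Pulling both functions back along `T` makes them functions of a single coordinate.
    refine ⟨max n n', fun y => φ (T (F n) (y : K)) + ψ (T (F n') (y : K)),
      (hφ.comp_continuous (continuous_T_coe _ _)).add (hψ.comp_continuous (continuous_T_coe _ _)),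
      fun x => ?_⟩
    rw [ContinuousMap.add_apply, h, h', ← T_coord x.1 hn, ← T_coord x.1 hn']
  mul_mem' := by
    rintro f g ⟨n, φ, hφ, h⟩ ⟨n', ψ, hψ, h'⟩
    have hn := le_max_left n n'
    have hn' := le_max_right n n'
    refine ⟨max n n', fun y => φ (T (F n) (y : K)) * ψ (T (F n') (y : K)),
      (hφ.comp_continuous (continuous_T_coe _ _)).mul (hψ.comp_continuous (continuous_T_coe _ _)),
      fun x => ?_⟩
    rw [ContinuousMap.mul_apply, h, h', ← T_coord x.1 hn, ← T_coord x.1 hn']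

theorem isLocallyConstant_indicator_closedBall {X : Type*} [PseudoMetricSpace X]
    [IsUltrametricDist X] (x : X) {r : ℝ} (hr : r ≠ 0) :
    IsLocallyConstant ((Metric.closedBall x r).indicator (1 : X → ℂ)) :=
  ((1 : LocallyConstant X ℂ).indicator
    (IsUltrametricDist.isClopen_closedBall x hr)).isLocallyConstant

theorem separatesPoints_cylinderFunctions : (cylinderFunctions F).SeparatesPoints := by
  intro x y hxy
  obtain ⟨n, hn⟩ : ∃ n, x.1.1 n ≠ y.1.1 n := by
    by_contra! h
    exact hxy (Subtype.ext (Subtype.ext (funext h)))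
  have hd : 0 < dist (y.1.1 n) (x.1.1 n) := dist_pos.mpr hn.symm
  set φ : F n → ℂ := (Metric.closedBall (x.1.1 n) (dist (y.1.1 n) (x.1.1 n) / 2)).indicator 1
  have hφ : IsLocallyConstant φ := isLocallyConstant_indicator_closedBall _ (half_pos hd).ne'
  refine ⟨_, ⟨⟨fun z => φ (z.1.1 n), hφ.continuous.comp ((continuous_coord F n).comp
    continuous_subtype_val)⟩, ⟨n, φ, hφ, fun _ => rfl⟩, rfl⟩, ?_⟩
  have hx : φ (x.1.1 n) = 1 := Set.indicator_of_mem (Metric.mem_closedBall_self (half_pos hd).le) 1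
  have hy : φ (y.1.1 n) = 0 := Set.indicator_of_notMem (by
    rw [Metric.mem_closedBall, not_le]; exact half_lt_self hd) 1
  simp [hx, hy]

/-- Every continuous function is uniformly close to a test function on `S`. -/
theorem exists_testFunction_near (hk : IsNormalized k) {g : KBar F → ℂ}
    (hg : Continuous g) {ε : ℝ} (hε : 0 < ε) :
    ∃ f ∈ testFunctions F, ∀ x ∈ S F, ‖f x - g x‖ < ε := by
  have : CompactSpace (S F) := isCompact_iff_compactSpace.mp isCompact_S
  have htop := ContinuousMap.starSubalgebra_topologicalClosure_eq_top_of_separatesPoints _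
    (separatesPoints_cylinderFunctions (F := F))
  let g' : C(S F, ℂ) := ⟨fun x => g x, hg.comp continuous_subtype_val⟩
  have hmem : g' ∈ closure (cylinderFunctions F : Set C(S F, ℂ)) := by
    rw [← StarSubalgebra.topologicalClosure_coe, htop]
    trivial
  obtain ⟨f, ⟨n, φ, hφ, hf⟩, hlt⟩ := Metric.mem_closure_iff.mp hmem ε hε
  have hp : ProperSpace (F n) := FiniteDimensional.proper k (F n)
  -- Cutting off to this clopen compact ball gives compact support and changes nothing on `S`, whose
  -- `n`-th coordinates all lie in it.
  set B := Metric.closedBall (0 : F n) (dualRadius (F n))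
  have hB : IsLocallyConstant (B.indicator φ) :=
    (LocallyConstant.indicator ⟨φ, hφ⟩ (IsUltrametricDist.isClopen_closedBall 0
      (dualRadius_pos (F n) hk).ne')).isLocallyConstant
  refine ⟨fun x => B.indicator φ (x.1 n), ⟨n, _, hB, ?_, rfl⟩, fun x hx => ?_⟩
  · exact HasCompactSupport.intro (isCompact_closedBall 0 (dualRadius (F n))) fun y hy =>
      Set.indicator_of_notMem hy φ
  · have hxB : x.1 n ∈ B := mem_closedBall_zero_iff.mpr (hx n)
    have h1 := ContinuousMap.dist_lt_iff hε |>.mp hlt ⟨x, hx⟩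
    rw [dist_comm, dist_eq_norm, hf] at h1
    change ‖B.indicator φ (x.1 n) - g x‖ < ε
    rw [Set.indicator_of_mem hxB]
    exact h1

/-- Bounded continuous functions are dense for finite `s`. Since `μ` is a probability measure
carried by `S`, uniform closeness on `S` gives closeness in every `L_s`. -/
theorem dense_testFunctions (hk : IsNormalized k) {μ : Measure (KBar F)}
    [IsProbabilityMeasure μ] (hS : μ (S F)ᶜ = 0) {s : ℝ≥0∞} [Fact (1 ≤ s)] (hs : s ≠ ∞) :
    Dense {g : Lp ℂ s μ | ∃ f ∈ testFunctions F, g =ᵐ[μ] f} := by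
  let _ := TopologicalSpace.upgradeIsCompletelyMetrizable (KBar F)
  intro h
  refine (mem_closure_iff_nhds_basis Metric.nhds_basis_closedEBall).2 fun ε hε => ?_
  have hε2 : ε / 2 ≠ 0 := (ENNReal.half_pos hε.ne').ne'
  obtain ⟨g, hg, hgm⟩ := (Lp.memLp h).exists_boundedContinuous_eLpNorm_sub_le hs hε2
  -- Here `ε` is an extended real and may be infinite, in which case any positive `δ` serves.
  obtain ⟨δ, hδ, hδε⟩ : ∃ δ : ℝ, 0 < δ ∧ ENNReal.ofReal δ ≤ ε / 2 := by
    rcases eq_or_ne (ε / 2) ∞ with htop | htop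
    · exact ⟨1, one_pos, htop ▸ le_top⟩
    · exact ⟨(ε / 2).toReal, ENNReal.toReal_pos hε2 htop, (ENNReal.ofReal_toReal htop).le⟩
  obtain ⟨f, hf, hfg⟩ := exists_testFunction_near hk g.continuous hδ
  have hfm := memLp_of_mem_testFunctions (μ := μ) hf s
  refine ⟨hfm.toLp f, ⟨f, hf, hfm.coeFn_toLp⟩, ?_⟩
  have h1 : eLpNorm ((g : KBar F → ℂ) - f) s μ ≤ ε / 2 := by
    refine (eLpNorm_le_of_ae_bound (C := δ) ?_).trans ?_
    · filter_upwards [compl_mem_ae_iff.mpr hS] with x hx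
      rw [compl_compl] at hx
      rw [Pi.sub_apply, norm_sub_rev]
      exact (hfg x hx).le
    · simpa using hδε
  rw [Metric.mem_closedEBall, edist_comm, Lp.edist_def]
  have h2 : eLpNorm (⇑h - ⇑(hfm.toLp f)) s μ = eLpNorm ((⇑h - ⇑g) + (⇑g - f)) s μ := by
    refine eLpNorm_congr_ae ?_
    filter_upwards [hfm.coeFn_toLp] with x hx
    simp [hx]
  rw [h2]
  refine (eLpNorm_add_le ((Lp.aestronglyMeasurable h).sub hgm.1) (hgm.1.sub hfm.1)
    (Fact.out : 1 ≤ s)).trans ?_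
  exact (add_le_add hg h1).trans (ENNReal.add_halves ε).le

end TestFunctions

end LocalFieldTower

theorem theorem1 {k K : Type*}
    -- a non-Archimedean local field of characteristic zero with its normalized absolute value
    [NontriviallyNormedField k] [IsUltrametricDist k] [ProperSpace k] [CharZero k]
    (hk : IsNormalized k)
    -- an algebraic extension with the absolute value that extends the one of `k`
    [NormedField K] [NormedAlgebra k K] [IsUltrametricDist K] [Algebra.IsAlgebraic k K]
    -- an increasing sequence of finite extensions of `k`, starting from `k`, with union `K`
    (F : ℕ → IntermediateField k K) [∀ n, FiniteDimensional k (F n)]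
    (hF0 : F 0 = ⊥) (hFmono : Monotone F) (hFunion : ∀ x : K, ∃ n, x ∈ F n)
    (χ : AddChar k Circle) (hχ : IsRankZero χ) :
    ∃ μ : Measure (KBar F),
      IsGaussian F χ μ ∧ (∀ ν : Measure (KBar F), IsGaussian F χ ν → ν = μ) ∧
      -- (a)
      μ (S F)ᶜ = 0 ∧
      -- (b)
      (∀ y ∈ S F, μ.map (fun x => x + y) = μ) ∧
      -- (c)
      (∀ y ∉ S F, (μ.map (fun x => x + y)).MutuallySingular μ) ∧
      -- (d)
      (∀ (n : ℕ) (a : F n), a ≠ 0 →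
        (∃ N : ℤ, normalizedAbs (F n) a = (residueCard (F n) : ℝ) ^ N) ∧
        ∀ N : ℤ, normalizedAbs (F n) a = (residueCard (F n) : ℝ) ^ N →
          essSup (fun x => ‖pairing F n a x‖ₑ) μ =
            ENNReal.ofReal
              ((residueCard k : ℝ) ^ (-⌊-(N : ℚ) / (ramificationIndex (F n) : ℚ)⌋))) ∧
      -- (e)
      (∀ (s : ℝ≥0∞) [Fact (1 ≤ s)], s ≠ ∞ →
        (∀ f ∈ testFunctions F, MemLp f s μ) ∧
        Dense {g : Lp ℂ s μ | ∃ f ∈ testFunctions F, g =ᵐ[μ] f}) := by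
  obtain ⟨μ, hμ, hμS, hinv, hpos⟩ := exists_invariant_probability_of_isCompact (subgroupS F)
    (coe_subgroupS (F := F) hk ▸ isCompact_S (F := F))
  rw [coe_subgroupS hk] at hμS hpos
  have hinvS : ∀ y ∈ S F, μ.map (fun x => x + y) = μ := fun y hy => hinv y ((mem_S_iff hk).mp hy)
  have hG := isGaussian_of_invariant hk hFmono hχ hμS hinvS
  exact ⟨μ, hG, fun ν hν => hG.unique hFmono hχ hν, hμS, hinvS,
    fun y hy => mutuallySingular_map_add hk hμS hy,
    fun n a ha => ⟨exists_normalizedAbs_eq_zpow hk (F n) ha,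
      fun N hN => essSup_enorm_pairing hk hFmono hμS hpos hN⟩,
    fun s _ hs => ⟨fun f hf => memLp_of_mem_testFunctions hf s, dense_testFunctions hk hμS hs⟩⟩
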